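/- Let $n_1,n_2,N,d_1,d_2,k,r_1,r_2$ be natural numbers with $1\le k\le\min\{n_1,n_2\}$, $n_1\le r_1$ and $n_2\le r_2$. Let $\mathcal A:\mathbb R^{n_1\times n_2}\to\mathbb R^N$ be linear, $b\in\mathbb R^N$, and let $X_r\in\mathbb R^{n_1\times d_1}$, $X_c\in\mathbb R^{n_2\times d_2}$ be feature matrices. For $f:\mathbb R^{d_1}\to\mathbb R$ write $f(X_r)\in\mathbb R^{n_1}$ for the vector of values of $f$ at the rows of $X_r$; for $f=(f_1,\dots,f_k)$ let $f(X_r)\in\mathbb R^{n_1\times k}$ have columns $f_i(X_r)$; similarly for $X_c$. Let $(\cdot)_+$ be the entrywise positive part. Let the link-function classes be $F_r=\{\varphi_r(\theta):\theta\in\mathbb R^{r_1}\}$ and $F_c=\{\varphi_c(\theta):\theta\in\mathbb R^{r_2}\}$, where $\varphi_r,\varphi_c$ are linear maps from the parameter spaces to the real functions on $\mathbb R^{d_1}$, $\mathbb R^{d_2}$, and suppose that the Jacobian matrices of $\theta\mapsto\varphi_r(\theta)(X_r)\in\mathbb R^{n_1}$ and $\theta\mapsto\varphi_c(\theta)(X_c)\in\mathbb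 R^{n_2}$ have full rank (that is, ranks $n_1$ and $n_2$). Consider the problem $$\min_{V,\ f_r\in F_r^k,\ f_c\in F_c^k}\ h(V,f_r,f_c)=\bigl\|V-(f_r(X_r))_+\,(f_c(X_c))_+^{T}\bigr\|_F^2\quad\text{subject to}\quad \mathcal A(V)=b,\ V\ge 0. \qquad(P)$$ The HALSX algorithm starts from arbitrary matrices $F_r^0\in\mathbb R_+^{n_1\times k}$, $F_c^0\in\mathbb R_+^{n_2\times k}$ (the $i$-th columns of $F_r^t$, $F_c^t$ are denoted $\mathbf f_{r,i}^t$, $\mathbf f_{c,i}^t$) and for $t=0,1,2,\dots$ does the following, where any minimizer may be taken if there are several: 1. $V^t\in\arg\min\{\|V-F_r^t(F_c^t)^T\|_F^2:\mathcal A(V)=b,\ V\ge0\}$ and $R:=V^t-F_r^t(F_c^t)^T$. 2. For $i=1,\dots,k$: $R_i:=R+\mathbf f_{r,i}^t(\mathbf f_{c,i}^t)^T$; $f_{r,i}^{t+1}\in\arg\min_{f\in F_r}\|R_i-f(X_r)(\mathbf f_{c,i}^t)^T\|_F^2$; $\mathbf f_{r,i}^{t+1}:=(f_{r,i}^{t+1}(X_r))_+$;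 $R:=R_i-\mathbf f_{r,i}^{t+1}(\mathbf f_{c,i}^t)^T$. 3. For $i=1,\dots,k$: $R_i:=R+\mathbf f_{r,i}^{t+1}(\mathbf f_{c,i}^t)^T$; $f_{c,i}^{t+1}\in\arg\min_{f\in F_c}\|R_i-\mathbf f_{r,i}^{t+1}f(X_c)^T\|_F^2$; $\mathbf f_{c,i}^{t+1}:=(f_{c,i}^{t+1}(X_c))_+$; $R:=R_i-\mathbf f_{r,i}^{t+1}(\mathbf f_{c,i}^{t+1})^T$. Call a feasible point $x$ of $(P)$ *critical* if for every feasible $y$ the one-sided directional derivative $\lim_{s\downarrow0}\bigl(h(x+s(y-x))-h(x)\bigr)/s$ exists and is $\ge0$. Then, for every infinite run of HALSX, every full-rank limit point is a critical point of $(P)$. Precisely: (a) If $(\bar V,\bar f_r,\bar f_c)$ is a limit point (for pointwise convergence of the link functions) of the sequence $(V^t,f_r^t,f_c^t)_{t\ge1}$ and the matrices $(\bar f_r(X_r))_+$ and $(\bar f_c(X_c))_+$ have full rank $k$, then $(\bar V,\bar f_r,\bar f_c)$ is a critical point of $(P)$. (b) If $(\bar V,\bar F_r,\bar F_c)$ is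 a limit point of the sequence $(V^t,F_r^t,F_c^t)$ and $\bar F_r,\bar F_c$ have full rank $k$, then there are $\bar f_r\in F_r^k$, $\bar f_c\in F_c^k$ with $(\bar f_r(X_r))_+=\bar F_r$ and $(\bar f_c(X_c))_+=\bar F_c$, and for all such $\bar f_r,\bar f_c$ the point $(\bar V,\bar f_r,\bar f_c)$ is a critical point of $(P)$. -/

import Mathlib

open Filter Topology

/-- The squared Frobenius norm of a real matrix. -/
def frobSq {m n : ℕ} (M : Matrix (Fin m) (Fin n) ℝ) : ℝ :=
  ∑ i, ∑ j, M i j ^ 2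

/-- A matrix is of full rank if its rank is the smaller one of its two dimensions. -/
def IsFullRank {m n : ℕ} (M : Matrix (Fin m) (Fin n) ℝ) : Prop :=
  M.rank = min m n

/-- The Jacobian matrix at `θ` of a function `g : ℝ^r → ℝ^n`. -/
noncomputable def jacobian {r n : ℕ} (g : (Fin r → ℝ) → (Fin n → ℝ)) (θ : Fin r → ℝ) :
    Matrix (Fin n) (Fin r) ℝ :=
  LinearMap.toMatrix' (fderiv ℝ g θ : (Fin r → ℝ) →ₗ[ℝ] (Fin n → ℝ))

/-- `f(X)`: the vector of the values of `f` at the rows of the feature matrix `X`. -/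
def evalRows {n d : ℕ} (X : Matrix (Fin n) (Fin d) ℝ) (f : (Fin d → ℝ) → ℝ) : Fin n → ℝ :=
  fun i => f (X i)

/-- `(f(X))₊` for `f = (f_1, …, f_k)`: the `n × k` matrix whose `j`-th column is the positive
part of the vector `f_j(X)`. -/
def factorMatrix {n d k : ℕ} (X : Matrix (Fin n) (Fin d) ℝ) (f : Fin k → (Fin d → ℝ) → ℝ) :
    Matrix (Fin n) (Fin k) ℝ :=
  Matrix.of fun i j => max 0 (evalRows X (f j) i)

/-- The matrices with `A V = b` and `V ≥ 0`. -/
def feasibleMatrices {n₁ n₂ N : ℕ} (A : Matrix (Fin n₁) (Fin n₂) ℝ →ₗ[ℝ] (Fin N → ℝ))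
    (b : Fin N → ℝ) : Set (Matrix (Fin n₁) (Fin n₂) ℝ) :=
  {V | A V = b ∧ ∀ i j, 0 ≤ V i j}

/-- The space of the variables `(V, f_r, f_c)` of the optimization problem, before the
constraints are imposed. -/
abbrev Variables (n₁ n₂ d₁ d₂ k : ℕ) : Type :=
  Matrix (Fin n₁) (Fin n₂) ℝ × (Fin k → (Fin d₁ → ℝ) → ℝ) × (Fin k → (Fin d₂ → ℝ) → ℝ)

/-- The objective function `‖V - (f_r(X_r))₊ (f_c(X_c))₊ᵀ‖_F²`. -/
def objective {n₁ n₂ d₁ d₂ k : ℕ}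
    (Xr : Matrix (Fin n₁) (Fin d₁) ℝ) (Xc : Matrix (Fin n₂) (Fin d₂) ℝ)
    (x : Variables n₁ n₂ d₁ d₂ k) : ℝ :=
  frobSq (x.1 - factorMatrix Xr x.2.1 * (factorMatrix Xc x.2.2).transpose)

/-- The feasible set of the optimization problem: `A V = b`, `V ≥ 0`, `f_r ∈ Sr^k`,
`f_c ∈ Sc^k`. -/
def feasibleSet {n₁ n₂ N d₁ d₂ : ℕ}
    (A : Matrix (Fin n₁) (Fin n₂) ℝ →ₗ[ℝ] (Fin N → ℝ)) (b : Fin N → ℝ)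
    (Sr : Set ((Fin d₁ → ℝ) → ℝ)) (Sc : Set ((Fin d₂ → ℝ) → ℝ)) (k : ℕ) :
    Set (Variables n₁ n₂ d₁ d₂ k) :=
  {x | x.1 ∈ feasibleMatrices A b ∧ (∀ i, x.2.1 i ∈ Sr) ∧ (∀ i, x.2.2 i ∈ Sc)}

/-- `x` is a critical (first-order stationary) point of the problem of minimizing `h` over the
convex set `C`: it is feasible, and for all feasible `y` the one-sided directional derivative of
`h` at `x` in the direction `y - x` exists and is nonnegative. For a differentiable `h` this is
the condition `⟨∇h(x), y - x⟩ ≥ 0` for all `y ∈ C`. -/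
def IsCriticalPointOn {E : Type*} [AddCommGroup E] [Module ℝ E] (h : E → ℝ) (C : Set E)
    (x : E) : Prop :=
  x ∈ C ∧ ∀ y ∈ C, ∃ D : ℝ, 0 ≤ D ∧
    Tendsto (fun s : ℝ => (h (x + s • (y - x)) - h x) / s) (𝓝[>] 0) (𝓝 D)

/-- `x` is one of the minimizers of `h` over the set `C`. -/
def IsArgminOn {α : Type*} (h : α → ℝ) (C : Set α) (x : α) : Prop :=
  x ∈ C ∧ IsMinOn h C x

/-- An infinite run of the HALSX algorithm, started at arbitrary nonnegative factor matrices
`Fr 0`, `Fc 0`. Wherever a minimizer is not unique, any one may be taken. -/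
structure HALSXRun {n₁ n₂ N d₁ d₂ : ℕ}
    (A : Matrix (Fin n₁) (Fin n₂) ℝ →ₗ[ℝ] (Fin N → ℝ)) (b : Fin N → ℝ)
    (Xr : Matrix (Fin n₁) (Fin d₁) ℝ) (Xc : Matrix (Fin n₂) (Fin d₂) ℝ)
    (Sr : Set ((Fin d₁ → ℝ) → ℝ)) (Sc : Set ((Fin d₂ → ℝ) → ℝ)) (k : ℕ) where
  /-- The matrices `V^t`. -/
  V : ℕ → Matrix (Fin n₁) (Fin n₂) ℝ
  /-- The row factor matrices `F_r^t`. -/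
  Fr : ℕ → Matrix (Fin n₁) (Fin k) ℝ
  /-- The column factor matrices `F_c^t`. -/
  Fc : ℕ → Matrix (Fin n₂) (Fin k) ℝ
  /-- The row link functions `f_{r,i}^t`. They are computed for `t ≥ 1`; the values at `t = 0`
  play no role. -/
  fr : ℕ → Fin k → (Fin d₁ → ℝ) → ℝ
  /-- The column link functions `f_{c,i}^t`, computed for `t ≥ 1`. -/
  fc : ℕ → Fin k → (Fin d₂ → ℝ) → ℝ
  /-- `Rr t i` is the residual matrix `R^t` after `i` passes through the first inner loop. -/
  Rr : ℕ → ℕ → Matrix (Fin n₁) (Fin n₂) ℝ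
  /-- `Rc t i` is the residual matrix `R^t` after `i` passes through the second inner loop. -/
  Rc : ℕ → ℕ → Matrix (Fin n₁) (Fin n₂) ℝ
  Fr_zero_nonneg : ∀ i j, 0 ≤ Fr 0 i j
  Fc_zero_nonneg : ∀ i j, 0 ≤ Fc 0 i j
  V_argmin : ∀ t, IsArgminOn (fun W => frobSq (W - Fr t * (Fc t).transpose))
    (feasibleMatrices A b) (V t)
  Rr_zero : ∀ t, Rr t 0 = V t - Fr t * (Fc t).transpose
  /-- `f_{r,i}^{t+1}` minimizes `‖R_i^t - f(X_r) (f_{c,i}^t)ᵀ‖_F²` over `f ∈ Sr`, where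
  `R_i^t = R^t + f_{r,i}^t (f_{c,i}^t)ᵀ`. -/
  fr_argmin : ∀ t (i : Fin k), IsArgminOn
    (fun f => frobSq ((Rr t i + Matrix.vecMulVec ((Fr t).col i) ((Fc t).col i))
      - Matrix.vecMulVec (evalRows Xr f) ((Fc t).col i))) Sr (fr (t + 1) i)
  Fr_succ : ∀ t, Fr (t + 1) = factorMatrix Xr (fr (t + 1))
  Rr_succ : ∀ t (i : Fin k), Rr t (i + 1) =
    (Rr t i + Matrix.vecMulVec ((Fr t).col i) ((Fc t).col i))
      - Matrix.vecMulVec ((Fr (t + 1)).col i) ((Fc t).col i)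
  Rc_zero : ∀ t, Rc t 0 = Rr t k
  /-- `f_{c,i}^{t+1}` minimizes `‖R_i^t - f_{r,i}^{t+1} f(X_c)ᵀ‖_F²` over `f ∈ Sc`, where
  `R_i^t = R^t + f_{r,i}^{t+1} (f_{c,i}^t)ᵀ`. -/
  fc_argmin : ∀ t (i : Fin k), IsArgminOn
    (fun f => frobSq ((Rc t i + Matrix.vecMulVec ((Fr (t + 1)).col i) ((Fc t).col i))
      - Matrix.vecMulVec ((Fr (t + 1)).col i) (evalRows Xc f))) Sc (fc (t + 1) i)
  Fc_succ : ∀ t, Fc (t + 1) = factorMatrix Xc (fc (t + 1))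
  Rc_succ : ∀ t (i : Fin k), Rc t (i + 1) =
    (Rc t i + Matrix.vecMulVec ((Fr (t + 1)).col i) ((Fc t).col i))
      - Matrix.vecMulVec ((Fr (t + 1)).col i) ((Fc (t + 1)).col i)

/-! The full-rank Jacobian makes evaluation at the feature rows surjective onto all vectors, so each
link-function step is an unconstrained rank-one least squares problem over vectors. Its Hessian is a
multiple of the identity, hence the positive part of a minimizer solves the nonnegative problem
(`dotProduct_mulVec_nonpos_of_posPart`): HALSX is block coordinate descent for nonnegative factors.

Each column update lowers the objective by at least `‖g_i‖² ‖f_i - f_i'‖²`, where `g_i` is the fixed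
column (`frobSq_succ_add_le`). The objective is monotone and nonnegative, so these decreases tend to
0. Where the limit columns are nonzero, old and new factors have the same limit
(`tendsto_of_isHALSSweep`), and the variational inequalities of all blocks hold at one common limit
residual.

Positive parts are affine for small positive steps, so the one-sided derivative splits into a `V`, a
row and a column term, each nonnegative by its inequality (`isCriticalPointOn_of_variational`). -/

/-- The Frobenius inner product of two real matrices. -/
def frobInner {m n : ℕ} (M P : Matrix (Fin m) (Fin n) ℝ) : ℝ :=
  ∑ i, ∑ j, M i j * P i j

/-! ### Frobenius inner product and norm. -/

section FrobeniusInner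

variable {m n : ℕ} (M P Q : Matrix (Fin m) (Fin n) ℝ)

lemma frobInner_self : frobInner M M = frobSq M := by
  simp only [frobInner, frobSq, sq]

lemma frobSq_nonneg : 0 ≤ frobSq M :=
  Finset.sum_nonneg fun _ _ => Finset.sum_nonneg fun _ _ => sq_nonneg _

lemma frobInner_add_right : frobInner M (P + Q) = frobInner M P + frobInner M Q := by
  simp only [frobInner, Matrix.add_apply, mul_add, Finset.sum_add_distrib]

lemma frobInner_sub_right : frobInner M (P - Q) = frobInner M P - frobInner M Q := by
  simp only [frobInner, Matrix.sub_apply, mul_sub, Finset.sum_sub_distrib]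

lemma frobInner_sum_right {ι : Type*} (s : Finset ι) (P : ι → Matrix (Fin m) (Fin n) ℝ) :
    frobInner M (∑ i ∈ s, P i) = ∑ i ∈ s, frobInner M (P i) := by
  classical
  induction s using Finset.induction_on with
  | empty => simp [frobInner]
  | insert a s ha ih => rw [Finset.sum_insert ha, Finset.sum_insert ha, frobInner_add_right, ih]

lemma frobInner_transpose : frobInner M.transpose P.transpose = frobInner M P := by
  simp only [frobInner, Matrix.transpose_apply]
  exact Finset.sum_comm

lemma frobSq_transpose : frobSq M.transpose = frobSq M := by
  rw [← frobInner_self, frobInner_transpose, frobInner_self]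

lemma frobSq_add_smul (s : ℝ) :
    frobSq (M + s • P) = frobSq M + s * (2 * frobInner M P) + s ^ 2 * frobSq P := by
  simp only [frobInner, frobSq, Matrix.add_apply, Matrix.smul_apply, smul_eq_mul, Finset.mul_sum,
    ← Finset.sum_add_distrib]
  exact Finset.sum_congr rfl fun _ _ => Finset.sum_congr rfl fun _ _ => by ring

lemma frobInner_vecMulVec (u : Fin m → ℝ) (c : Fin n → ℝ) :
    frobInner M (Matrix.vecMulVec u c) = u ⬝ᵥ M.mulVec c := by
  simp only [frobInner, Matrix.vecMulVec_apply, dotProduct, Matrix.mulVec, Finset.mul_sum]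
  exact Finset.sum_congr rfl fun _ _ => Finset.sum_congr rfl fun _ _ => by ring

lemma frobSq_vecMulVec (u : Fin m → ℝ) (c : Fin n → ℝ) :
    frobSq (Matrix.vecMulVec u c) = (c ⬝ᵥ c) * (u ⬝ᵥ u) := by
  simp only [frobSq, Matrix.vecMulVec_apply, dotProduct, Finset.sum_mul_sum]
  rw [Finset.sum_comm]
  exact Finset.sum_congr rfl fun _ _ => Finset.sum_congr rfl fun _ _ => by ring

lemma continuous_frobInner :
    Continuous fun p : Matrix (Fin m) (Fin n) ℝ × Matrix (Fin m) (Fin n) ℝ =>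
      frobInner p.1 p.2 := by
  unfold frobInner
  exact continuous_finsetSum _ fun i _ => continuous_finsetSum _ fun j _ =>
    (continuous_fst.matrix_elem i j).mul (continuous_snd.matrix_elem i j)

lemma continuous_frobSq : Continuous (frobSq : Matrix (Fin m) (Fin n) ℝ → ℝ) := by
  have h := (continuous_frobInner (m := m) (n := n)).comp (continuous_id.prodMk continuous_id)
  exact h.congr fun M => frobInner_self M

end FrobeniusInner

/-! ### Rank-one least squares and its positive part. -/

/-- A quadratic `s * a + s ^ 2 * b` that is nonnegative for small positive `s` has a nonnegative
linear coefficient. -/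
lemma nonneg_of_quadratic_nonneg {a b : ℝ} (h : ∀ s : ℝ, 0 < s → s ≤ 1 → 0 ≤ s * a + s ^ 2 * b) :
    0 ≤ a := by
  have ht : Tendsto (fun s : ℝ => a + s * b) (𝓝[>] 0) (𝓝 a) := by
    have : Continuous fun s : ℝ => a + s * b := by fun_prop
    simpa using (this.tendsto 0).mono_left nhdsWithin_le_nhds
  refine ge_of_tendsto ht ?_
  filter_upwards [Ioc_mem_nhdsGT (zero_lt_one' ℝ)] with s hs
  have := h s hs.1 hs.2
  have h2 : s * a + s ^ 2 * b = s * (a + s * b) := by ring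
  rw [h2] at this
  exact nonneg_of_mul_nonneg_right this hs.1

/-- The normal equations of the rank-one least squares problem. -/
lemma mulVec_eq_of_forall_frobSq_le {m n : ℕ} {R : Matrix (Fin m) (Fin n) ℝ} {u : Fin m → ℝ}
    {c : Fin n → ℝ}
    (h : ∀ w, frobSq (R - Matrix.vecMulVec u c) ≤ frobSq (R - Matrix.vecMulVec w c)) :
    (R - Matrix.vecMulVec u c).mulVec c = 0 := by
  have key : ∀ d : Fin m → ℝ, 0 ≤ d ⬝ᵥ (R - Matrix.vecMulVec u c).mulVec c := by
    intro d
    have h0 : 0 ≤ 2 * (d ⬝ᵥ (R - Matrix.vecMulVec u c).mulVec c) := by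
      refine nonneg_of_quadratic_nonneg (b := frobSq (Matrix.vecMulVec d c)) fun s _ _ => ?_
      have h1 := h (u - s • d)
      have h2 : R - Matrix.vecMulVec (u - s • d) c
          = (R - Matrix.vecMulVec u c) + s • Matrix.vecMulVec d c := by
        ext i j
        simp only [Matrix.sub_apply, Matrix.add_apply, Matrix.smul_apply, Matrix.vecMulVec_apply,
          Pi.sub_apply, Pi.smul_apply, smul_eq_mul]
        ring
      rw [h2, frobSq_add_smul, frobInner_vecMulVec] at h1
      linarith
    linarith
  have h3 := key (-((R - Matrix.vecMulVec u c).mulVec c))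
  rw [neg_dotProduct] at h3
  have h4 : 0 ≤ (R - Matrix.vecMulVec u c).mulVec c ⬝ᵥ (R - Matrix.vecMulVec u c).mulVec c :=
    Finset.sum_nonneg fun _ _ => mul_self_nonneg _
  exact dotProduct_self_eq_zero.1 (by linarith)

/-- The positive part of the unconstrained minimizer of a rank-one least squares problem satisfies
the variational inequality of the problem with the constraint of nonnegativity. -/
lemma dotProduct_mulVec_nonpos_of_posPart {m n : ℕ} {R : Matrix (Fin m) (Fin n) ℝ}
    {u v w : Fin m → ℝ} {c : Fin n → ℝ}
    (h : (R - Matrix.vecMulVec u c).mulVec c = 0) (hv : ∀ a, v a = max 0 (u a))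
    (hw : ∀ a, 0 ≤ w a) :
    (w - v) ⬝ᵥ (R - Matrix.vecMulVec v c).mulVec c ≤ 0 := by
  -- By the normal equations only the part `(u - v) cᵀ` of the residual contributes, so the
  -- inequality reduces to `(w a - v a) (u a - v a) ≤ 0` in each coordinate. The case `c = 0` is
  -- included.
  have h1 : R - Matrix.vecMulVec v c
      = (R - Matrix.vecMulVec u c) + Matrix.vecMulVec (u - v) c := by
    rw [Matrix.sub_vecMulVec]; abel
  rw [h1, Matrix.add_mulVec, h, zero_add]
  refine Finset.sum_nonpos fun a _ => ?_
  have h2 : (Matrix.vecMulVec (u - v) c).mulVec c a = (u a - v a) * (c ⬝ᵥ c) := by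
    simp only [Matrix.mulVec, dotProduct, Matrix.vecMulVec_apply, Pi.sub_apply, Finset.mul_sum]
    exact Finset.sum_congr rfl fun _ _ => by ring
  rw [h2, Pi.sub_apply, ← mul_assoc]
  refine mul_nonpos_of_nonpos_of_nonneg ?_ (Finset.sum_nonneg fun _ _ => mul_self_nonneg _)
  rw [hv a]
  rcases le_total 0 (u a) with hu | hu
  · rw [max_eq_right hu]; simp
  · rw [max_eq_left hu]; nlinarith [hw a]

/-! ### Decrease of the residual in one sweep. -/

/-- One sweep over the columns of the factor `F`, which becomes `F'`, the factor `G` being fixed.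
`R i` is the residual after `i` columns; each new column satisfies the variational inequality of
its nonnegative least squares problem. -/
structure IsHALSSweep {m n k : ℕ} (R : ℕ → Matrix (Fin m) (Fin n) ℝ)
    (F F' : Matrix (Fin m) (Fin k) ℝ) (G : Matrix (Fin n) (Fin k) ℝ) : Prop where
  nonneg : ∀ a i, 0 ≤ F a i
  step : ∀ i : Fin k, R i = R (i + 1) - Matrix.vecMulVec (F.col i - F'.col i) (G.col i)
  variational : ∀ (i : Fin k) (w : Fin m → ℝ), (∀ a, 0 ≤ w a) →
    (w - F'.col i) ⬝ᵥ (R (i + 1)).mulVec (G.col i) ≤ 0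

lemma isHALSSweep_of_argmin {m n k : ℕ} {R : ℕ → Matrix (Fin m) (Fin n) ℝ}
    {F F' : Matrix (Fin m) (Fin k) ℝ} {G : Matrix (Fin n) (Fin k) ℝ} (U : Fin k → Fin m → ℝ)
    (hF : ∀ a i, 0 ≤ F a i)
    (hU : ∀ i : Fin k, ∀ w,
      frobSq ((R i + Matrix.vecMulVec (F.col i) (G.col i)) - Matrix.vecMulVec (U i) (G.col i)) ≤
      frobSq ((R i + Matrix.vecMulVec (F.col i) (G.col i)) - Matrix.vecMulVec w (G.col i)))
    (hF' : ∀ a i, F' a i = max 0 (U i a))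
    (hR : ∀ i : Fin k, R (i + 1) = (R i + Matrix.vecMulVec (F.col i) (G.col i))
      - Matrix.vecMulVec (F'.col i) (G.col i)) :
    IsHALSSweep R F F' G where
  nonneg := hF
  step i := by rw [hR i, Matrix.sub_vecMulVec]; abel
  variational i w hw := by
    rw [hR i]
    exact dotProduct_mulVec_nonpos_of_posPart (mulVec_eq_of_forall_frobSq_le (hU i))
      (fun a => hF' a i) hw

lemma mul_transpose_eq_sum_vecMulVec {m n k : ℕ} (F : Matrix (Fin m) (Fin k) ℝ)
    (G : Matrix (Fin n) (Fin k) ℝ) :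
    F * G.transpose = ∑ i, Matrix.vecMulVec (F.col i) (G.col i) := by
  ext a b
  simp [Matrix.mul_apply, Matrix.sum_apply, Matrix.vecMulVec_apply, Matrix.col_apply]

namespace IsHALSSweep

variable {m n k : ℕ} {R : ℕ → Matrix (Fin m) (Fin n) ℝ} {F F' : Matrix (Fin m) (Fin k) ℝ}
  {G : Matrix (Fin n) (Fin k) ℝ}

lemma residual_eq (h : IsHALSSweep R F F' G) :
    R k = R 0 + F * G.transpose - F' * G.transpose := by
  have h1 : R k - R 0 = ∑ i ∈ Finset.range k, (R (i + 1) - R i) :=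
    (Finset.sum_range_sub R k).symm
  rw [← Fin.sum_univ_eq_sum_range (fun i => R (i + 1) - R i)] at h1
  have h2 : ∀ i : Fin k, R (i + 1) - R i
      = Matrix.vecMulVec (F.col i) (G.col i) - Matrix.vecMulVec (F'.col i) (G.col i) := by
    intro i
    rw [h.step i, Matrix.sub_vecMulVec]; abel
  rw [Finset.sum_congr rfl fun i _ => h2 i, Finset.sum_sub_distrib,
    ← mul_transpose_eq_sum_vecMulVec, ← mul_transpose_eq_sum_vecMulVec] at h1
  rw [add_sub_assoc, ← h1]; abel

/-- The old column is nonnegative, so it is admissible in the variational inequality of the new one;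
this gives the cross term of the expanded square the right sign. -/
lemma frobSq_succ_add_le (h : IsHALSSweep R F F' G) (i : Fin k) :
    frobSq (R (i + 1))
      + (G.col i ⬝ᵥ G.col i) * ((F.col i - F'.col i) ⬝ᵥ (F.col i - F'.col i))
      ≤ frobSq (R i) := by
  have h1 := h.variational i (F.col i) fun a => h.nonneg a i
  have h2 := frobSq_add_smul (R (i + 1)) (Matrix.vecMulVec (F.col i - F'.col i) (G.col i)) (-1)
  rw [neg_one_smul, ← sub_eq_add_neg, ← h.step i, frobInner_vecMulVec, frobSq_vecMulVec] at h2
  rw [h2]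
  linarith

lemma frobSq_succ_le (h : IsHALSSweep R F F' G) (i : Fin k) :
    frobSq (R (i + 1)) ≤ frobSq (R i) := by
  have h1 := h.frobSq_succ_add_le i
  have h2 : 0 ≤ (G.col i ⬝ᵥ G.col i) * ((F.col i - F'.col i) ⬝ᵥ (F.col i - F'.col i)) :=
    mul_nonneg (Finset.sum_nonneg fun _ _ => mul_self_nonneg _)
      (Finset.sum_nonneg fun _ _ => mul_self_nonneg _)
  linarith

lemma frobSq_le_frobSq (h : IsHALSSweep R F F' G) {i j : ℕ} (hij : i ≤ j) (hj : j ≤ k) :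
    frobSq (R j) ≤ frobSq (R i) := by
  induction j, hij using Nat.le_induction with
  | base => exact le_rfl
  | succ j _ ih => exact (h.frobSq_succ_le ⟨j, hj⟩).trans (ih (by omega))

lemma mul_dotProduct_le (h : IsHALSSweep R F F' G) (i : Fin k) :
    (G.col i ⬝ᵥ G.col i) * ((F.col i - F'.col i) ⬝ᵥ (F.col i - F'.col i))
      ≤ frobSq (R 0) - frobSq (R k) := by
  have h1 := h.frobSq_succ_add_le i
  have h2 := h.frobSq_le_frobSq (Nat.zero_le i) i.2.le
  have h3 := h.frobSq_le_frobSq (i := i + 1) i.2 le_rfl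
  linarith

end IsHALSSweep

/-! ### Passage to the limit in a sweep. -/

section Limit

variable {m n k : ℕ} {l : Filter ℕ} {R : ℕ → ℕ → Matrix (Fin m) (Fin n) ℝ}
  {F F' : ℕ → Matrix (Fin m) (Fin k) ℝ} {G : ℕ → Matrix (Fin n) (Fin k) ℝ}
  {Fb : Matrix (Fin m) (Fin k) ℝ} {Gb : Matrix (Fin n) (Fin k) ℝ}
  {Rb : Matrix (Fin m) (Fin n) ℝ}

lemma tendsto_matrix_iff {l : Filter ℕ} {f : ℕ → Matrix (Fin m) (Fin n) ℝ}
    {M : Matrix (Fin m) (Fin n) ℝ} :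
    Tendsto f l (𝓝 M) ↔ ∀ i j, Tendsto (fun t => f t i j) l (𝓝 (M i j)) := by
  refine (tendsto_pi_nhds (f := f) (g := M)).trans (forall_congr' fun i => ?_)
  exact tendsto_pi_nhds

/-- If the decrease of the residual during the sweeps vanishes in the limit, and the columns of the
limit of the fixed factors do not vanish, then the updated factors have the same limit as the
factors before the sweep. -/
lemma tendsto_of_isHALSSweep (h : ∀ t, IsHALSSweep (R t) (F t) (F' t) (G t))
    (hF : Tendsto F l (𝓝 Fb)) (hG : Tendsto G l (𝓝 Gb)) (hGb : ∀ i, Gb.col i ≠ 0)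
    (hgap : Tendsto (fun t => frobSq (R t 0) - frobSq (R t k)) l (𝓝 0)) :
    Tendsto F' l (𝓝 Fb) := by
  rw [tendsto_matrix_iff] at hF hG ⊢
  intro a i
  have hGG : Tendsto (fun t => (G t).col i ⬝ᵥ (G t).col i) l (𝓝 (Gb.col i ⬝ᵥ Gb.col i)) :=
    tendsto_finsetSum _ fun b _ => (hG b i).mul (hG b i)
  have hpos : 0 < Gb.col i ⬝ᵥ Gb.col i :=
    lt_of_le_of_ne (Finset.sum_nonneg fun _ _ => mul_self_nonneg _)
      fun h0 => hGb i (dotProduct_self_eq_zero.1 h0.symm)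
  have hq := hgap.div hGG hpos.ne'
  rw [zero_div] at hq
  -- Squeeze between 0 and the total decrease divided by `‖g_i‖²`, which is eventually positive
  -- because its limit is.
  have hsq : Tendsto (fun t => (F t a i - F' t a i) ^ 2) l (𝓝 0) := by
    refine tendsto_of_tendsto_of_tendsto_of_le_of_le' tendsto_const_nhds hq
      (Eventually.of_forall fun t => sq_nonneg _) ?_
    filter_upwards [hGG.eventually (lt_mem_nhds hpos)] with t ht
    rw [Pi.div_apply, le_div_iff₀ ht]
    refine le_trans ?_ ((h t).mul_dotProduct_le i)
    rw [mul_comm]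
    refine mul_le_mul_of_nonneg_left ?_ ht.le
    have := Finset.single_le_sum
      (f := fun c => ((F t).col i - (F' t).col i) c * ((F t).col i - (F' t).col i) c)
      (fun _ _ => mul_self_nonneg _) (Finset.mem_univ a)
    simpa [sq, dotProduct] using this
  have habs : Tendsto (fun t => |F t a i - F' t a i|) l (𝓝 0) := by
    have := hsq.sqrt
    simpa [Real.sqrt_sq_eq_abs] using this
  have hsub := (tendsto_zero_iff_abs_tendsto_zero _).2 habs
  simpa using (hF a i).sub hsub

/-- Consecutive residuals differ by `(F_i - F'_i) G_iᵀ`, which vanishes in the limit; hence every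
block sees the same limit residual. -/
lemma tendsto_residual_of_isHALSSweep (h : ∀ t, IsHALSSweep (R t) (F t) (F' t) (G t))
    (hF : Tendsto F l (𝓝 Fb)) (hF' : Tendsto F' l (𝓝 Fb)) (hG : Tendsto G l (𝓝 Gb))
    (hR : Tendsto (fun t => R t 0) l (𝓝 Rb)) {i : ℕ} (hi : i ≤ k) :
    Tendsto (fun t => R t i) l (𝓝 Rb) := by
  induction i with
  | zero => exact hR
  | succ i ih =>
    have h1 := ih (by omega)
    have h2 : ∀ t, R t (i + 1) = R t i
        + Matrix.vecMulVec ((F t).col ⟨i, hi⟩ - (F' t).col ⟨i, hi⟩) ((G t).col ⟨i, hi⟩) := by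
      intro t
      have := (h t).step ⟨i, hi⟩
      simp only at this
      rw [this]; abel
    rw [tendsto_matrix_iff] at hF hF' hG h1 ⊢
    intro a b
    simp only [h2]
    have h3 := (h1 a b).add (((hF a ⟨i, hi⟩).sub (hF' a ⟨i, hi⟩)).mul (hG b ⟨i, hi⟩))
    simpa [Matrix.vecMulVec_apply, Matrix.col_apply] using h3

lemma variational_of_isHALSSweep [l.NeBot] (h : ∀ t, IsHALSSweep (R t) (F t) (F' t) (G t))
    (hF : Tendsto F l (𝓝 Fb)) (hF' : Tendsto F' l (𝓝 Fb)) (hG : Tendsto G l (𝓝 Gb))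
    (hR : Tendsto (fun t => R t 0) l (𝓝 Rb)) (i : Fin k) {w : Fin m → ℝ} (hw : ∀ a, 0 ≤ w a) :
    (w - Fb.col i) ⬝ᵥ Rb.mulVec (Gb.col i) ≤ 0 := by
  have hRi := tendsto_residual_of_isHALSSweep h hF hF' hG hR (i := i + 1) i.2
  refine le_of_tendsto (f := fun t => (w - (F' t).col i) ⬝ᵥ (R t (i + 1)).mulVec ((G t).col i))
    (x := l) ?_ (Eventually.of_forall fun t => (h t).variational i w hw)
  rw [tendsto_matrix_iff] at hF' hG hRi
  refine tendsto_finsetSum _ fun a _ => ((tendsto_const_nhds.sub (hF' a i))).mul ?_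
  simp only [Matrix.mulVec, dotProduct]
  exact tendsto_finsetSum _ fun b _ => (hRi a b).mul (hG b i)

end Limit

/-! ### From blockwise variational inequalities to criticality. -/

section Criticality

/-- The slope `e` is the one-sided derivative of the positive part: 0, `max 0 d` or `d` according to
the sign of `u`. The identity is exact for small `s`, so no remainder has to be estimated. -/
lemma exists_eventually_posPart_affine (u d : ℝ) :
    ∃ e : ℝ, ∀ᶠ s : ℝ in 𝓝[>] 0, max 0 (u + s * d) = max 0 u + s * e := by
  have hc : Tendsto (fun s : ℝ => u + s * d) (𝓝[>] 0) (𝓝 u) := by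
    have : Continuous fun s : ℝ => u + s * d := by fun_prop
    simpa using (this.tendsto 0).mono_left nhdsWithin_le_nhds
  rcases lt_trichotomy u 0 with hu | rfl | hu
  · refine ⟨0, ?_⟩
    filter_upwards [hc.eventually (gt_mem_nhds hu)] with s hs
    rw [max_eq_left hs.le, max_eq_left hu.le]; ring
  · refine ⟨max 0 d, ?_⟩
    filter_upwards [self_mem_nhdsWithin] with s hs
    have hs' : (0 : ℝ) ≤ s := le_of_lt hs
    rw [zero_add, max_self, zero_add, mul_max_of_nonneg _ _ hs', mul_zero]
  · refine ⟨d, ?_⟩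
    filter_upwards [hc.eventually (lt_mem_nhds hu)] with s hs
    rw [max_eq_right hs.le, max_eq_right hu.le]

lemma factorMatrix_nonneg {n d k : ℕ} (X : Matrix (Fin n) (Fin d) ℝ)
    (f : Fin k → (Fin d → ℝ) → ℝ) (a : Fin n) (i : Fin k) : 0 ≤ factorMatrix X f a i :=
  le_max_left _ _

lemma exists_eventually_factorMatrix_affine {n d k : ℕ} (X : Matrix (Fin n) (Fin d) ℝ)
    (f g : Fin k → (Fin d → ℝ) → ℝ) :
    ∃ D : Matrix (Fin n) (Fin k) ℝ, ∀ᶠ s : ℝ in 𝓝[>] 0,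
      factorMatrix X (f + s • g) = factorMatrix X f + s • D := by
  choose D hD using fun (a : Fin n) (i : Fin k) =>
    exists_eventually_posPart_affine (f i (X a)) (g i (X a))
  refine ⟨Matrix.of D, ?_⟩
  have h := eventually_all.2 fun a => eventually_all.2 fun i => hD a i
  filter_upwards [h] with s hs
  ext a i
  simpa [factorMatrix, evalRows] using hs a i

/-- A direction that keeps the factor nonnegative is an ascent direction, if each column of the
factor satisfies the variational inequality. -/
lemma frobInner_mul_transpose_nonpos {m n k : ℕ} {R : Matrix (Fin m) (Fin n) ℝ}
    {F D : Matrix (Fin m) (Fin k) ℝ} {G : Matrix (Fin n) (Fin k) ℝ} {s : ℝ} (hs : 0 < s)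
    (hD : ∀ a i, 0 ≤ (F + s • D) a i)
    (h : ∀ (i : Fin k) (w : Fin m → ℝ), (∀ a, 0 ≤ w a) →
      (w - F.col i) ⬝ᵥ R.mulVec (G.col i) ≤ 0) :
    frobInner R (D * G.transpose) ≤ 0 := by
  rw [mul_transpose_eq_sum_vecMulVec, frobInner_sum_right]
  refine Finset.sum_nonpos fun i _ => ?_
  rw [frobInner_vecMulVec]
  -- The shifted column is itself the test vector; the factor `s > 0` then cancels.
  have h1 := h i ((F + s • D).col i) fun a => hD a i
  have h2 : (F + s • D).col i - F.col i = s • D.col i := by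
    ext a; simp [Matrix.col_apply]
  rw [h2, smul_dotProduct, smul_eq_mul] at h1
  exact nonpos_of_mul_nonpos_right h1 hs

/-- The term `s • Q` accommodates the product of the two factor increments, which is of second order
in `s`. -/
lemma tendsto_frobSq_quotient {m n : ℕ} (R P Q : Matrix (Fin m) (Fin n) ℝ) :
    Tendsto (fun s : ℝ => (frobSq (R + s • (P - s • Q)) - frobSq R) / s) (𝓝[>] 0)
      (𝓝 (2 * frobInner R P)) := by
  have hc : Continuous fun s : ℝ => 2 * frobInner R (P - s • Q) + s * frobSq (P - s • Q) := by
    have h1 : Continuous fun s : ℝ => P - s • Q := by fun_prop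
    exact (continuous_const.mul (continuous_frobInner.comp (continuous_const.prodMk h1))).add
      (continuous_id.mul (continuous_frobSq.comp h1))
  have h2 := (hc.tendsto 0).mono_left (nhdsWithin_le_nhds (s := Set.Ioi 0))
  simp only [zero_smul, sub_zero, zero_mul, add_zero] at h2
  refine h2.congr' ?_
  filter_upwards [self_mem_nhdsWithin] with s hs
  have hs' : s ≠ 0 := ne_of_gt hs
  rw [frobSq_add_smul]
  field_simp
  ring

/-- A feasible point whose blocks all satisfy their variational inequalities is critical. -/
theorem isCriticalPointOn_of_variational {n₁ n₂ N d₁ d₂ k : ℕ}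
    {A : Matrix (Fin n₁) (Fin n₂) ℝ →ₗ[ℝ] (Fin N → ℝ)} {b : Fin N → ℝ}
    {Xr : Matrix (Fin n₁) (Fin d₁) ℝ} {Xc : Matrix (Fin n₂) (Fin d₂) ℝ}
    {Sr : Set ((Fin d₁ → ℝ) → ℝ)} {Sc : Set ((Fin d₂ → ℝ) → ℝ)}
    {V R : Matrix (Fin n₁) (Fin n₂) ℝ} {fr : Fin k → (Fin d₁ → ℝ) → ℝ}
    {fc : Fin k → (Fin d₂ → ℝ) → ℝ}
    (hx : (V, fr, fc) ∈ feasibleSet A b Sr Sc k)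
    (hR : R = V - factorMatrix Xr fr * (factorMatrix Xc fc).transpose)
    (hV : ∀ W ∈ feasibleMatrices A b, 0 ≤ frobInner R (W - V))
    (hr : ∀ (i : Fin k) (w : Fin n₁ → ℝ), (∀ a, 0 ≤ w a) →
      (w - (factorMatrix Xr fr).col i) ⬝ᵥ R.mulVec ((factorMatrix Xc fc).col i) ≤ 0)
    (hc : ∀ (i : Fin k) (w : Fin n₂ → ℝ), (∀ a, 0 ≤ w a) →
      (w - (factorMatrix Xc fc).col i) ⬝ᵥ R.transpose.mulVec ((factorMatrix Xr fr).col i) ≤ 0) :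
    IsCriticalPointOn (objective Xr Xc) (feasibleSet A b Sr Sc k) (V, fr, fc) := by
  refine ⟨hx, ?_⟩
  rintro ⟨W, gr, gc⟩ hy
  obtain ⟨D, hD⟩ := exists_eventually_factorMatrix_affine Xr fr (gr - fr)
  obtain ⟨E, hE⟩ := exists_eventually_factorMatrix_affine Xc fc (gc - fc)
  set F := factorMatrix Xr fr with hF
  set G := factorMatrix Xc fc with hG
  refine ⟨2 * frobInner R ((W - V) - D * G.transpose - F * E.transpose), ?_, ?_⟩
  -- A single `s > 0` at which both expansions hold suffices: there `F + s • D` and `G + s • E` are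
  -- positive parts, hence nonnegative.
  · obtain ⟨s, hs, hDs, hEs⟩ := ((eventually_mem_nhdsWithin (a := (0 : ℝ)) (s := Set.Ioi 0)).and
      (hD.and hE)).exists
    have h1 : frobInner R (D * G.transpose) ≤ 0 :=
      frobInner_mul_transpose_nonpos hs
        (fun a i => by rw [← hDs]; exact factorMatrix_nonneg _ _ a i) hr
    have h2 : frobInner R.transpose (E * F.transpose) ≤ 0 :=
      frobInner_mul_transpose_nonpos hs
        (fun a i => by rw [← hEs]; exact factorMatrix_nonneg _ _ a i) hc
    have h3 : E * F.transpose = (F * E.transpose).transpose := by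
      rw [Matrix.transpose_mul, Matrix.transpose_transpose]
    rw [h3, frobInner_transpose] at h2
    rw [frobInner_sub_right, frobInner_sub_right]
    have h4 := hV W hy.1
    linarith
  · refine (tendsto_frobSq_quotient R _ (D * E.transpose)).congr' ?_
    filter_upwards [hD, hE] with s hDs hEs
    have h1 : objective Xr Xc (V, fr, fc) = frobSq R := by rw [hR]; rfl
    have h2 : objective Xr Xc ((V, fr, fc) + s • ((W, gr, gc) - (V, fr, fc)))
        = frobSq (R + s • ((W - V) - D * G.transpose - F * E.transpose
          - s • (D * E.transpose))) := by
      have : objective Xr Xc ((V, fr, fc) + s • ((W, gr, gc) - (V, fr, fc)))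
          = frobSq (V + s • (W - V) - factorMatrix Xr (fr + s • (gr - fr))
            * (factorMatrix Xc (fc + s • (gc - fc))).transpose) := rfl
      rw [this, hDs, hEs, hR]
      congr 1
      simp only [Matrix.transpose_add, Matrix.transpose_smul, Matrix.add_mul, Matrix.mul_add,
        Matrix.smul_mul, Matrix.mul_smul, smul_sub, smul_add]
      abel
    rw [h1, h2]

end Criticality

/-! ### Projection onto the feasible matrices. -/

section Feasible

variable {n₁ n₂ N : ℕ} (A : Matrix (Fin n₁) (Fin n₂) ℝ →ₗ[ℝ] (Fin N → ℝ)) (b : Fin N → ℝ)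

lemma isClosed_feasibleMatrices : IsClosed (feasibleMatrices A b) := by
  have hA : Continuous A := A.continuous_of_finiteDimensional
  have hset : feasibleMatrices A b = {V | A V = b} ∩ ⋂ i, ⋂ j, {V | 0 ≤ V i j} := by
    ext V
    simp [feasibleMatrices]
  rw [hset]
  exact (isClosed_eq hA continuous_const).inter (isClosed_iInter fun i => isClosed_iInter fun j =>
    isClosed_le continuous_const (continuous_id.matrix_elem i j))

variable {A b}

lemma frobInner_nonneg_of_isArgminOn {M V : Matrix (Fin n₁) (Fin n₂) ℝ}
    (h : IsArgminOn (fun W => frobSq (W - M)) (feasibleMatrices A b) V)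
    {W : Matrix (Fin n₁) (Fin n₂) ℝ} (hW : W ∈ feasibleMatrices A b) :
    0 ≤ frobInner (V - M) (W - V) := by
  have h0 : 0 ≤ 2 * frobInner (V - M) (W - V) := by
    refine nonneg_of_quadratic_nonneg (b := frobSq (W - V)) fun s hs hs1 => ?_
    have hmem : V + s • (W - V) ∈ feasibleMatrices A b := by
      refine ⟨by rw [map_add, map_smul, map_sub, h.1.1, hW.1]; simp, fun i j => ?_⟩
      have h1 := h.1.2 i j
      have h2 := hW.2 i j
      simp only [Matrix.add_apply, Matrix.smul_apply, Matrix.sub_apply, smul_eq_mul]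
      -- The entry is the convex combination `(1 - s) V i j + s W i j`.
      nlinarith [mul_nonneg hs.le h2, mul_nonneg (sub_nonneg.2 hs1) h1]
    have h3 : frobSq (V - M) ≤ frobSq (V + s • (W - V) - M) := h.2 hmem
    rw [add_sub_right_comm, frobSq_add_smul] at h3
    linarith
  linarith

end Feasible

/-! ### Convergence along a run of the algorithm. -/

namespace HALSXRun

variable {n₁ n₂ N d₁ d₂ k : ℕ} {A : Matrix (Fin n₁) (Fin n₂) ℝ →ₗ[ℝ] (Fin N → ℝ)}
  {b : Fin N → ℝ} {Xr : Matrix (Fin n₁) (Fin d₁) ℝ} {Xc : Matrix (Fin n₂) (Fin d₂) ℝ}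
  {Sr : Set ((Fin d₁ → ℝ) → ℝ)} {Sc : Set ((Fin d₂ → ℝ) → ℝ)}
  (run : HALSXRun A b Xr Xc Sr Sc k)

lemma Fr_nonneg (t : ℕ) (a : Fin n₁) (i : Fin k) : 0 ≤ run.Fr t a i := by
  cases t with
  | zero => exact run.Fr_zero_nonneg a i
  | succ t => rw [run.Fr_succ]; exact factorMatrix_nonneg _ _ a i

lemma Fc_nonneg (t : ℕ) (a : Fin n₂) (i : Fin k) : 0 ≤ run.Fc t a i := by
  cases t with
  | zero => exact run.Fc_zero_nonneg a i
  | succ t => rw [run.Fc_succ]; exact factorMatrix_nonneg _ _ a i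

lemma isHALSSweep_row (hSr : ∀ u, ∃ f ∈ Sr, evalRows Xr f = u) (t : ℕ) :
    IsHALSSweep (run.Rr t) (run.Fr t) (run.Fr (t + 1)) (run.Fc t) := by
  refine isHALSSweep_of_argmin (fun i => evalRows Xr (run.fr (t + 1) i)) (run.Fr_nonneg t)
    (fun i w => ?_) (fun a i => by rw [run.Fr_succ]; rfl) (run.Rr_succ t)
  -- By surjectivity any competing vector `w` comes from a link function in the class.
  obtain ⟨f, hf, rfl⟩ := hSr w
  exact (run.fr_argmin t i).2 hf

/-- Transposition exchanges the roles of the two factors, so the column loop is again a sweep, with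
the already updated row factor fixed. -/
lemma isHALSSweep_col (hSc : ∀ u, ∃ f ∈ Sc, evalRows Xc f = u) (t : ℕ) :
    IsHALSSweep (fun i => (run.Rc t i).transpose) (run.Fc t) (run.Fc (t + 1))
      (run.Fr (t + 1)) := by
  refine isHALSSweep_of_argmin (fun i => evalRows Xc (run.fc (t + 1) i)) (run.Fc_nonneg t)
    (fun i w => ?_) (fun a i => by rw [run.Fc_succ]; rfl) (fun i => ?_)
  · obtain ⟨f, hf, rfl⟩ := hSc w
    have h := (run.fc_argmin t i).2 hf
    simp only [Set.mem_ofPred_eq] at h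
    rw [← frobSq_transpose, ← frobSq_transpose (_ - Matrix.vecMulVec _ (evalRows Xc f))] at h
    simpa only [Matrix.transpose_sub, Matrix.transpose_add, Matrix.transpose_vecMulVec] using h
  · simp only [run.Rc_succ t i, Matrix.transpose_sub, Matrix.transpose_add,
      Matrix.transpose_vecMulVec]

lemma Rc_last (hSr : ∀ u, ∃ f ∈ Sr, evalRows Xr f = u)
    (hSc : ∀ u, ∃ f ∈ Sc, evalRows Xc f = u) (t : ℕ) :
    run.Rc t k = run.V t - run.Fr (t + 1) * (run.Fc (t + 1)).transpose := by
  have h1 := (run.isHALSSweep_row hSr t).residual_eq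
  have h2 := congrArg Matrix.transpose (run.isHALSSweep_col hSc t).residual_eq
  simp only [Matrix.transpose_sub, Matrix.transpose_add, Matrix.transpose_mul,
    Matrix.transpose_transpose] at h2
  rw [h2, run.Rc_zero, h1, run.Rr_zero]
  abel

/-- Along a run, the objective decreases from one iteration to the next, also between the two
sweeps. -/
lemma frobSq_chain (hSr : ∀ u, ∃ f ∈ Sr, evalRows Xr f = u)
    (hSc : ∀ u, ∃ f ∈ Sc, evalRows Xc f = u) (t : ℕ) :
    frobSq (run.Rr (t + 1) 0) ≤ frobSq (run.Rc t k) ∧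
    frobSq (run.Rc t k) ≤ frobSq (run.Rc t 0) ∧
    frobSq (run.Rc t 0) = frobSq (run.Rr t k) ∧
    frobSq (run.Rr t k) ≤ frobSq (run.Rr t 0) := by
  refine ⟨?_, ?_, by rw [run.Rc_zero], ?_⟩
  · rw [run.Rc_last hSr hSc, run.Rr_zero]
    -- `V^t` is feasible, so it competes with `V^(t+1)` for the same new factors.
    exact (run.V_argmin (t + 1)).2 (run.V_argmin t).1
  · have h := (run.isHALSSweep_col hSc t).frobSq_le_frobSq (Nat.zero_le k) le_rfl
    simpa only [frobSq_transpose] using h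
  · exact (run.isHALSSweep_row hSr t).frobSq_le_frobSq (Nat.zero_le k) le_rfl

/-- A nonincreasing sequence bounded below by 0 converges, so its consecutive differences vanish. -/
lemma tendsto_decrease (hSr : ∀ u, ∃ f ∈ Sr, evalRows Xr f = u)
    (hSc : ∀ u, ∃ f ∈ Sc, evalRows Xc f = u) :
    Tendsto (fun t => frobSq (run.Rr t 0) - frobSq (run.Rr (t + 1) 0)) atTop (𝓝 0) := by
  have hanti : Antitone fun t => frobSq (run.Rr t 0) := antitone_nat_of_succ_le fun t => by
    obtain ⟨h1, h2, h3, h4⟩ := run.frobSq_chain hSr hSc t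
    linarith
  have hlim := tendsto_atTop_ciInf hanti ⟨0, by rintro _ ⟨t, rfl⟩; exact frobSq_nonneg _⟩
  simpa using hlim.sub ((tendsto_add_atTop_iff_nat 1).2 hlim)

/-- The limit of a convergent subfamily of the iterates, with nonvanishing columns of the factors,
is a critical point. -/
theorem isCriticalPointOn_of_tendsto (hSr : ∀ u, ∃ f ∈ Sr, evalRows Xr f = u)
    (hSc : ∀ u, ∃ f ∈ Sc, evalRows Xc f = u) {l : Filter ℕ} [l.NeBot] (hl : l ≤ atTop)
    {V : Matrix (Fin n₁) (Fin n₂) ℝ} {fr : Fin k → (Fin d₁ → ℝ) → ℝ}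
    {fc : Fin k → (Fin d₂ → ℝ) → ℝ} (hfr : ∀ i, fr i ∈ Sr) (hfc : ∀ i, fc i ∈ Sc)
    (hV : Tendsto run.V l (𝓝 V)) (hFr : Tendsto run.Fr l (𝓝 (factorMatrix Xr fr)))
    (hFc : Tendsto run.Fc l (𝓝 (factorMatrix Xc fc)))
    (hFr0 : ∀ i, (factorMatrix Xr fr).col i ≠ 0) (hFc0 : ∀ i, (factorMatrix Xc fc).col i ≠ 0) :
    IsCriticalPointOn (objective Xr Xc) (feasibleSet A b Sr Sc k) (V, fr, fc) := by
  have hdec := (run.tendsto_decrease hSr hSc).mono_left hl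
  have hrow := run.isHALSSweep_row hSr
  have hcol := run.isHALSSweep_col hSc
  have hR : Tendsto (fun t => run.Rr t 0) l
      (𝓝 (V - factorMatrix Xr fr * (factorMatrix Xc fc).transpose)) := by
    simp only [run.Rr_zero]
    have hc : Continuous fun p : Matrix (Fin n₁) (Fin k) ℝ × Matrix (Fin n₂) (Fin k) ℝ =>
        p.1 * p.2.transpose := continuous_fst.matrix_mul continuous_snd.matrix_transpose
    exact hV.sub ((hc.tendsto _).comp (hFr.prodMk_nhds hFc))
  -- The drop within one sweep is at most the drop over the whole iteration.
  have hgap_row : Tendsto (fun t => frobSq (run.Rr t 0) - frobSq (run.Rr t k)) l (𝓝 0) := by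
    refine squeeze_zero (fun t => ?_) (fun t => ?_) hdec <;>
    · obtain ⟨h1, h2, h3, h4⟩ := run.frobSq_chain hSr hSc t
      linarith
  have hFr' := tendsto_of_isHALSSweep hrow hFr hFc hFc0 hgap_row
  have hgap_col : Tendsto (fun t => frobSq (run.Rc t 0).transpose
      - frobSq (run.Rc t k).transpose) l (𝓝 0) := by
    simp only [frobSq_transpose]
    refine squeeze_zero (fun t => ?_) (fun t => ?_) hdec <;>
    · obtain ⟨h1, h2, h3, h4⟩ := run.frobSq_chain hSr hSc t
      linarith
  -- The fixed factor here is the updated `Fr (t + 1)`, so its limit `hFr'` from the row sweep is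
  -- needed beforehand.
  have hFc' := tendsto_of_isHALSSweep hcol hFc hFr' hFr0 hgap_col
  have hRc := tendsto_residual_of_isHALSSweep hrow hFr hFr' hFc hR le_rfl
  simp only [← run.Rc_zero] at hRc
  have hRc' := (continuous_id.matrix_transpose.tendsto _).comp hRc
  have hVmem : V ∈ feasibleMatrices A b :=
    (isClosed_feasibleMatrices A b).mem_of_tendsto hV
      (Eventually.of_forall fun t => (run.V_argmin t).1)
  refine isCriticalPointOn_of_variational ⟨hVmem, hfr, hfc⟩ rfl (fun W hW => ?_)
    (fun i w hw => variational_of_isHALSSweep hrow hFr hFr' hFc hR i hw)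
    (fun i w hw => variational_of_isHALSSweep hcol hFc hFc' hFr' hRc' i hw)
  have hlim := (continuous_frobInner.tendsto _).comp
    (hR.prodMk_nhds ((tendsto_const_nhds (x := W)).sub hV))
  refine ge_of_tendsto hlim (Eventually.of_forall fun t => ?_)
  simp only [Function.comp_apply, run.Rr_zero]
  exact frobInner_nonneg_of_isArgminOn (run.V_argmin t) hW

end HALSXRun

/-! ### Link functions, ranks and the main theorem. -/

lemma continuous_factorMatrix {n d k : ℕ} (X : Matrix (Fin n) (Fin d) ℝ) :
    Continuous (factorMatrix (k := k) X) :=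
  continuous_matrix fun a i =>
    continuous_const.max ((continuous_apply (X a)).comp (continuous_apply i))

/-- This keeps pointwise limits of link functions in the class: finite-dimensional subspaces are
closed. -/
lemma isClosed_range_of_finiteDimensional {r d : ℕ}
    (φ : (Fin r → ℝ) →ₗ[ℝ] ((Fin d → ℝ) → ℝ)) : IsClosed (Set.range φ) := by
  rw [← LinearMap.coe_range]
  exact Submodule.closed_of_finiteDimensional _

/-- The map from parameters to values is linear, so it is its own derivative, and the rank `n` of
its Jacobian means surjectivity. -/
lemma exists_mem_range_evalRows_eq {n d r : ℕ} (hr : n ≤ r) (X : Matrix (Fin n) (Fin d) ℝ)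
    (φ : (Fin r → ℝ) →ₗ[ℝ] ((Fin d → ℝ) → ℝ))
    (hJ : IsFullRank (jacobian (fun η => evalRows X (φ η)) 0)) (u : Fin n → ℝ) :
    ∃ f ∈ Set.range φ, evalRows X f = u := by
  let L : (Fin r → ℝ) →ₗ[ℝ] (Fin n → ℝ) := (LinearMap.funLeft ℝ ℝ X).comp φ
  have hL : (fun η => evalRows X (φ η)) = L.toContinuousLinearMap := rfl
  have hrank : Module.finrank ℝ (LinearMap.range L) = n := by
    have h1 : jacobian (fun η => evalRows X (φ η)) 0 = LinearMap.toMatrix' L := by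
      rw [hL, jacobian, ContinuousLinearMap.fderiv]
      rfl
    rw [IsFullRank, h1, min_eq_left hr, Matrix.rank, ← Matrix.toLin'_apply',
      Matrix.toLin'_toMatrix'] at hJ
    exact hJ
  have htop : LinearMap.range L = ⊤ :=
    Submodule.eq_top_of_finrank_eq (by rw [hrank, Module.finrank_fin_fun])
  obtain ⟨η, hη⟩ := LinearMap.range_eq_top.1 htop u
  exact ⟨φ η, ⟨η, rfl⟩, hη⟩

/-- Full rank enters the convergence argument only through the columns being nonzero. -/
lemma col_ne_zero_of_isFullRank {n k : ℕ} (hkn : k ≤ n) {F : Matrix (Fin n) (Fin k) ℝ}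
    (hF : IsFullRank F) (i : Fin k) : F.col i ≠ 0 := by
  have h : LinearIndependent ℝ F.col := by
    rw [linearIndependent_iff_card_eq_finrank_span, Set.finrank, ← Matrix.rank_eq_finrank_span_cols, hF,
      min_eq_right hkn, Fintype.card_fin]
  exact h.ne_zero i

theorem mainTheorem2 {n₁ n₂ N d₁ d₂ r₁ r₂ k : ℕ}
    (hk : 1 ≤ k) (hkn : k ≤ min n₁ n₂) (hr₁ : n₁ ≤ r₁) (hr₂ : n₂ ≤ r₂)
    (A : Matrix (Fin n₁) (Fin n₂) ℝ →ₗ[ℝ] (Fin N → ℝ)) (b : Fin N → ℝ)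
    (Xr : Matrix (Fin n₁) (Fin d₁) ℝ) (Xc : Matrix (Fin n₂) (Fin d₂) ℝ)
    -- the regression functions, linear in their parameters; the link functions are searched in
    -- the ranges of these two maps
    (φr : (Fin r₁ → ℝ) →ₗ[ℝ] ((Fin d₁ → ℝ) → ℝ))
    (φc : (Fin r₂ → ℝ) →ₗ[ℝ] ((Fin d₂ → ℝ) → ℝ))
    (hJr : ∀ θ, IsFullRank (jacobian (fun η => evalRows Xr (φr η)) θ))
    (hJc : ∀ θ, IsFullRank (jacobian (fun η => evalRows Xc (φc η)) θ))
    (run : HALSXRun A b Xr Xc (Set.range φr) (Set.range φc) k) :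
    -- limit points of the iterates `(V^t, f_r^t, f_c^t)`
    (∀ x : Variables n₁ n₂ d₁ d₂ k,
      MapClusterPt x atTop (fun t => (run.V t, run.fr t, run.fc t)) →
      IsFullRank (factorMatrix Xr x.2.1) → IsFullRank (factorMatrix Xc x.2.2) →
      IsCriticalPointOn (objective Xr Xc)
        (feasibleSet A b (Set.range φr) (Set.range φc) k) x) ∧
    -- limit points of the iterates `(V^t, F_r^t, F_c^t)`
    (∀ (V : Matrix (Fin n₁) (Fin n₂) ℝ) (Fr : Matrix (Fin n₁) (Fin k) ℝ)
        (Fc : Matrix (Fin n₂) (Fin k) ℝ),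
      MapClusterPt (V, Fr, Fc) atTop (fun t => (run.V t, run.Fr t, run.Fc t)) →
      IsFullRank Fr → IsFullRank Fc →
      (∃ fr fc, (∀ i, fr i ∈ Set.range φr) ∧ (∀ i, fc i ∈ Set.range φc) ∧
        factorMatrix Xr fr = Fr ∧ factorMatrix Xc fc = Fc) ∧
      ∀ fr fc, (∀ i, fr i ∈ Set.range φr) → (∀ i, fc i ∈ Set.range φc) →
        factorMatrix Xr fr = Fr → factorMatrix Xc fc = Fc →
        IsCriticalPointOn (objective Xr Xc)
          (feasibleSet A b (Set.range φr) (Set.range φc) k) (V, fr, fc)) := by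

  have hSr := exists_mem_range_evalRows_eq hr₁ Xr φr (hJr 0)
  have hSc := exists_mem_range_evalRows_eq hr₂ Xc φc (hJc 0)
  have hk₁ := hkn.trans (min_le_left _ _)
  have hk₂ := hkn.trans (min_le_right _ _)
  refine ⟨?_, ?_⟩
  · rintro ⟨V, fr, fc⟩ hx hfr hfc
    -- An ultrafilter finer than `atTop` replaces a subsequence, since the topology of pointwise
    -- convergence need not be first countable.
    obtain ⟨l, hl, hlim⟩ := mapClusterPt_iff_ultrafilter.1 hx
    have hV : Tendsto run.V l (𝓝 V) := (continuous_fst.tendsto _).comp hlim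
    have hr : Tendsto run.fr l (𝓝 fr) := (continuous_snd.fst.tendsto _).comp hlim
    have hc : Tendsto run.fc l (𝓝 fc) := (continuous_snd.snd.tendsto _).comp hlim
    -- The link functions at `t = 0` are arbitrary, so membership in the class and the identity with
    -- the factor matrices hold only from `t = 1` on.
    have hpos : ∀ᶠ t in (l : Filter ℕ), 1 ≤ t := hl (eventually_ge_atTop 1)
    refine run.isCriticalPointOn_of_tendsto hSr hSc hl (fun i => ?_) (fun i => ?_) hV ?_ ?_
      (col_ne_zero_of_isFullRank hk₁ hfr) (col_ne_zero_of_isFullRank hk₂ hfc)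
    · refine (isClosed_range_of_finiteDimensional φr).mem_of_tendsto
        (((continuous_apply i).tendsto _).comp hr) ?_
      filter_upwards [hpos] with t ht
      obtain ⟨t, rfl⟩ := Nat.exists_eq_add_of_le' ht
      exact (run.fr_argmin t i).1
    · refine (isClosed_range_of_finiteDimensional φc).mem_of_tendsto
        (((continuous_apply i).tendsto _).comp hc) ?_
      filter_upwards [hpos] with t ht
      obtain ⟨t, rfl⟩ := Nat.exists_eq_add_of_le' ht
      exact (run.fc_argmin t i).1
    · refine (((continuous_factorMatrix Xr).tendsto _).comp hr).congr' ?_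
      filter_upwards [hpos] with t ht
      obtain ⟨t, rfl⟩ := Nat.exists_eq_add_of_le' ht
      exact (run.Fr_succ t).symm
    · refine (((continuous_factorMatrix Xc).tendsto _).comp hc).congr' ?_
      filter_upwards [hpos] with t ht
      obtain ⟨t, rfl⟩ := Nat.exists_eq_add_of_le' ht
      exact (run.Fc_succ t).symm
  · intro V Fr Fc hx hFr hFc
    obtain ⟨l, hl, hlim⟩ := mapClusterPt_iff_ultrafilter.1 hx
    have hV : Tendsto run.V l (𝓝 V) := (continuous_fst.tendsto _).comp hlim
    have hr : Tendsto run.Fr l (𝓝 Fr) := (continuous_snd.fst.tendsto _).comp hlim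
    have hc : Tendsto run.Fc l (𝓝 Fc) := (continuous_snd.snd.tendsto _).comp hlim
    refine ⟨?_, ?_⟩
    -- Link functions interpolating the columns of the limit factors suffice: these factors are
    -- nonnegative as limits, hence equal to their positive parts.
    · choose fr hfr hfr' using fun i => hSr (Fr.col i)
      choose fc hfc hfc' using fun i => hSc (Fc.col i)
      refine ⟨fr, fc, hfr, hfc, ?_, ?_⟩
      · ext a i
        have h0 : 0 ≤ Fr a i := ge_of_tendsto (tendsto_matrix_iff.1 hr a i)
          (Eventually.of_forall fun t => run.Fr_nonneg t a i)
        simp [factorMatrix, hfr', Matrix.col_apply, h0]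
      · ext a i
        have h0 : 0 ≤ Fc a i := ge_of_tendsto (tendsto_matrix_iff.1 hc a i)
          (Eventually.of_forall fun t => run.Fc_nonneg t a i)
        simp [factorMatrix, hfc', Matrix.col_apply, h0]
    · rintro fr fc hfr hfc rfl rfl
      exact run.isCriticalPointOn_of_tendsto hSr hSc hl hfr hfc hV hr hc
        (col_ne_zero_of_isFullRank hk₁ hFr) (col_ne_zero_of_isFullRank hk₂ hFc)
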